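/- Let $n\ge 0$. A permutation $\sigma=\sigma_1\cdots\sigma_n$ of $[n]=\{1,\dots,n\}$ is \emph{simsun} if for every $k$ the subword of $\sigma$ formed by the letters $1,\dots,k$ (in the order in which they appear in $\sigma$) has no three consecutive letters $a>b>c$; it is \emph{double simsun} if both $\sigma$ and $\sigma^{-1}$ are simsun; and it is \emph{$213$-avoiding} if there are no indices $i<j<k$ with $\sigma_j<\sigma_i<\sigma_k$. Let $S_n$ be the secondary structure number, indexed so that $(S_0,S_1,S_2,\dots)=(1,1,2,4,8,17,37,\dots)$; that is, $S_n$ is the number of secondary structures on $n+1$ vertices, meaning sets of arcs $(i,j)$ with $1\le i$, $i+2\le j\le n+1$, such that each vertex lies on at most one arc and no two arcs $(i,j),(k,l)$ cross (never $i<k<j<l$). Then the number of $213$-avoiding double simsun permutations of $[n]$ equals $S_n$. This is also the number of Motzkin paths of length $n$ (lattice paths from $(0,0)$ to $(n,0)$ with steps $U=(1,1)$, $D=(1,-1)$, $L=(1,0)$ that never pass below the $x$-axis) that have no two consecutive down steps. -/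

import Mathlib

/-- The one-line word `σ₁ σ₂ ⋯ σₙ`, with letters in `{1, …, n}`, of a permutation. -/
def oneLine {n : ℕ} (σ : Equiv.Perm (Fin n)) : List ℕ :=
  List.ofFn fun i => (σ i : ℕ) + 1

/-- A word has a double descent: three consecutive letters `a > b > c`. -/
def HasDoubleDescent (w : List ℕ) : Prop :=
  ∃ a b c : ℕ, [a, b, c] <:+: w ∧ b < a ∧ c < b

/-- `σ` is simsun: for all `k`, the subword of `σ` formed by the letters `≤ k`
has no double descent. -/
def IsSimsun {n : ℕ} (σ : Equiv.Perm (Fin n)) : Prop :=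
  ∀ k : ℕ, ¬ HasDoubleDescent ((oneLine σ).filter (fun a => a ≤ k))

/-- `σ` is double simsun: both `σ` and its inverse are simsun. -/
def IsDoubleSimsun {n : ℕ} (σ : Equiv.Perm (Fin n)) : Prop :=
  IsSimsun σ ∧ IsSimsun σ⁻¹

/-- `σ` contains the pattern `ω`: some subsequence of `σ` is in the same relative order as `ω`. -/
def ContainsPattern {n t : ℕ} (σ : Equiv.Perm (Fin n)) (ω : Equiv.Perm (Fin t)) : Prop :=
  ∃ f : Fin t → Fin n, StrictMono f ∧ ∀ j k : Fin t, σ (f j) < σ (f k) ↔ ω j < ω k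

/-- The permutation with one-line word `213`. -/
def perm213 : Equiv.Perm (Fin 3) := Equiv.swap 0 1

/-- The set of `ω`-avoiding double simsun permutations of `[n]`; avoidance is asked of `σ` only. -/
def doubleSimsunAvoiding (n : ℕ) {t : ℕ} (ω : Equiv.Perm (Fin t)) :
    Set (Equiv.Perm (Fin n)) :=
  {σ | IsDoubleSimsun σ ∧ ¬ ContainsPattern σ ω}

/-- `A` is the set of arcs `(i, j)`, `i < j`, of a secondary structure on the vertices `1, …, m`:
arcs never join neighbouring vertices, every vertex lies on at most one arc, and
no two arcs cross. -/
structure IsSecondaryStructure (m : ℕ) (A : Finset (ℕ × ℕ)) : Prop where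
  one_le : ∀ p ∈ A, 1 ≤ p.1
  gap : ∀ p ∈ A, p.1 + 1 < p.2
  le : ∀ p ∈ A, p.2 ≤ m
  disjoint : ∀ p ∈ A, ∀ q ∈ A,
    (p.1 = q.1 ∨ p.1 = q.2 ∨ p.2 = q.1 ∨ p.2 = q.2) → p = q
  noncrossing : ∀ p ∈ A, ∀ q ∈ A, ¬ (p.1 < q.1 ∧ q.1 < p.2 ∧ p.2 < q.2)

/-- The secondary structure number `Sₙ`, indexed so that `S₀, S₁, S₂, … = 1, 1, 2, 4, 8, 17, …`:
the number of secondary structures on `n + 1` vertices. -/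
noncomputable def secondaryStructureNumber (n : ℕ) : ℕ :=
  {A : Finset (ℕ × ℕ) | IsSecondaryStructure (n + 1) A}.ncard

/-- The steps `U = (1, 1)`, `D = (1, -1)`, `L = (1, 0)`. -/
inductive MotzkinStep where
  | U : MotzkinStep
  | D : MotzkinStep
  | L : MotzkinStep
  deriving DecidableEq

/-- `w` is the sequence of steps of a Motzkin path of length `n`: it has `n` steps,
ends on the `x`-axis, and never passes below it. -/
structure IsMotzkinPath (n : ℕ) (w : List MotzkinStep) : Prop where
  length_eq : w.length = n
  count_eq : w.count MotzkinStep.U = w.count MotzkinStep.D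
  nonneg : ∀ p : List MotzkinStep, p <+: w → p.count MotzkinStep.D ≤ p.count MotzkinStep.U

/-- The Motzkin paths of length `n` with no two consecutive down steps. -/
def ddFreeMotzkinPaths (n : ℕ) : Set (List MotzkinStep) :=
  {w | IsMotzkinPath n w ∧ ¬ [MotzkinStep.D, MotzkinStep.D] <:+: w}

/-!
All three families are counted through one kind of plane tree, `FoldTree`, whose constructors of
weight `0, 1, 2, 3` and arity `0, 1, 1, 2` encode the equation `S = 1 + x S + x² S + x³ S²` of the
generating function of the secondary structure numbers.

A Motzkin path without two consecutive down steps is empty, `L P`, `U D P` or `U Q L D P`: the part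
below the first arch cannot end with a down step, so it is empty or ends with a level step. A
secondary structure on a nonempty interval of vertices is a single point, a free point followed by a
structure, an arc around a structure, or such an arc followed by a structure. These are bijections
with trees (`FoldTree.ncard_ddFreeMotzkinPaths`, `FoldTree.secondaryStructureNumber_eq`).

For permutations the key remark is that `213`-avoidance makes the simsun condition local: if
`a > b > c` are consecutive among the letters `≤ k`, then a letter `> k` after `b` would complete
a `213` with `a` and `b`, so `b` and `c` are adjacent, and the letter just before `b` is at least
`a`. Thus a `213`-avoiding permutation is simsun iff it has no double descent at all
(`isSimsun_iff`). As the pattern `213` is an involution, the inverse permutation can be treated in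
the same way, and double simsun means: no double descent, and no values `v + 2, v + 1, v` appearing
in this order (`admissible_permFun_iff`).

A `213`-avoiding permutation factors around its least letter as `A 0 B` with all letters of `A`
above those of `B`. If `A` is nonempty, the double simsun condition says that `A` and `B` are double
simsun, that `A` ends with an ascent (or is a single letter), and that in `B` the second largest
letter precedes the largest one (`Admissible.glue`, `fiber_pos`). The conditions on `A` and `B` are
exchanged by inversion, so they define equally many permutations (`ncard_topUp`); and a permutation
of length `n + 2` ending with an ascent ends with two consecutive values, so it is obtained from a
unique permutation of length `n + 1` by doubling the last letter
(`ncard_admissibleUpSet_succ`). With `f` the number wanted this gives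
`f (n + 1) = f n + ∑ f (a - 1) * g b` over `a + b = n`, `a > 0`, where `g 0 = 1` and
`g (b + 1) = f b`. This is the recurrence of the trees.
-/

/-! ### Trees -/

/-- Plane trees with a leaf `nil`, two kinds of unary nodes and one kind of binary node. -/
inductive FoldTree where
  | nil : FoldTree
  | point : FoldTree → FoldTree
  | arc : FoldTree → FoldTree
  | arcs : FoldTree → FoldTree → FoldTree

namespace FoldTree

/-- The size of a tree: the four constructors have weight `0, 1, 2, 3`. -/
def size : FoldTree → ℕ
  | nil => 0
  | point t => t.size + 1
  | arc l => l.size + 2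
  | arcs l r => l.size + r.size + 3

/-! ### Motzkin paths -/

open MotzkinStep

/-- The Motzkin path of a tree. In a binary node the level step separates the path under the first
arch from the down step closing that arch. -/
def path : FoldTree → List MotzkinStep
  | nil => []
  | point t => L :: t.path
  | arc l => U :: D :: l.path
  | arcs l r => U :: (l.path ++ L :: D :: r.path)

theorem length_path (t : FoldTree) : t.path.length = t.size := by
  induction t <;> simp_all [path, size]; omega

theorem count_path (t : FoldTree) : t.path.count U = t.path.count D := by
  induction t <;> simp_all [path, List.count_append]; omega

theorem prefix_path (t : FoldTree) : ∀ p, p <+: t.path → p.count D ≤ p.count U := by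
  induction t with
  | nil => intro p hp; simp [List.prefix_nil.1 hp]
  | point t ih =>
    intro p hp
    rcases List.prefix_cons_iff.1 hp with rfl | ⟨q, rfl, hq⟩
    · simp
    · simpa [List.count_cons] using ih q hq
  | arc l ih =>
    intro p hp
    rcases List.prefix_cons_iff.1 hp with rfl | ⟨q, rfl, hq⟩
    · simp
    rcases List.prefix_cons_iff.1 hq with rfl | ⟨q, rfl, hr⟩
    · simp
    · simpa [List.count_cons] using ih q hr
  | arcs l r ihl ihr =>
    intro p hp
    rcases List.prefix_cons_iff.1 hp with rfl | ⟨q, rfl, hq⟩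
    · simp
    rcases List.prefix_or_prefix_of_prefix hq (List.prefix_append _ _) with h | ⟨x, rfl⟩
    · have := ihl q h
      simp; omega
    · rw [List.prefix_append_right_inj] at hq
      have := l.count_path
      rcases List.prefix_cons_iff.1 hq with rfl | ⟨y, rfl, hy⟩
      · simp; omega
      rcases List.prefix_cons_iff.1 hy with rfl | ⟨z, rfl, hz⟩
      · simp [List.count_append]; omega
      · have := ihr z hz
        simp [List.count_append]; omega

/-- A path of a tree starts with `U` or `L`. -/
theorem head_path (t : FoldTree) (s : List MotzkinStep) (hs : s.head? ≠ some D) :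
    (t.path ++ s).head? ≠ some D := by
  cases t <;> simp_all [path]

theorem infix_DD_cons_iff (a : MotzkinStep) (w : List MotzkinStep) :
    [D, D] <:+: a :: w ↔ (a = D ∧ w.head? = some D) ∨ [D, D] <:+: w := by
  rw [List.infix_cons_iff, List.cons_prefix_cons]
  refine or_congr_left (and_congr eq_comm ?_)
  cases w with
  | nil => simp
  | cons b w => simp [List.cons_prefix_cons, @eq_comm _ D]

theorem not_DD_path (t : FoldTree) : ∀ s : List MotzkinStep, s.head? ≠ some D → ¬ [D, D] <:+: s →
    ¬ [D, D] <:+: t.path ++ s := by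
  induction t with
  | nil => intro s _ h; simpa [path] using h
  | point t ih =>
    intro s h1 h2
    simpa [path, infix_DD_cons_iff] using ih s h1 h2
  | arc l ih =>
    intro s h1 h2
    have h3 := l.head_path s h1
    have h4 := ih s h1 h2
    simp only [path, List.cons_append, infix_DD_cons_iff]
    simp only [h3, h4, and_false, or_false, reduceCtorEq, false_and, not_false_eq_true]
  | arcs l r ihl ihr =>
    intro s h1 h2
    have h3 := r.head_path s h1
    have h4 := ihr s h1 h2
    have h5 := ihl (L :: D :: (r.path ++ s)) (by simp) (by
      simp only [infix_DD_cons_iff]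
      simp only [h3, h4, and_false, or_false, reduceCtorEq, false_and, not_false_eq_true])
    simpa [path, infix_DD_cons_iff] using h5

/-- Unique readability. The restriction on the remainders is needed: `L :: L :: D :: q` would
otherwise be readable with either one or two letters in the first factor. -/
theorem path_append_inj (t : FoldTree) : ∀ (t' : FoldTree) (s s' : List MotzkinStep),
    (s = [] ∨ ∃ q, s = L :: D :: q) → (s' = [] ∨ ∃ q, s' = L :: D :: q) →
    t.path ++ s = t'.path ++ s' → t = t' ∧ s = s' := by
  have hd : ∀ s, (s = [] ∨ ∃ q, s = L :: D :: q) → s.head? ≠ some D := by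
    rintro s (rfl | ⟨q, rfl⟩) <;> simp
  induction t with
  | nil =>
    intro t' s s' hs hs' h
    cases t' with
    | nil => simpa [path] using h
    | point t' =>
      rcases hs with rfl | ⟨q, rfl⟩
      · simp [path] at h
      · have := t'.head_path s' (hd s' hs')
        simp only [path, List.nil_append, List.cons_append, List.cons.injEq, true_and] at h
        simp [← h] at this
    | arc t' => rcases hs with rfl | ⟨q, rfl⟩ <;> simp [path] at h
    | arcs l r => rcases hs with rfl | ⟨q, rfl⟩ <;> simp [path] at h
  | point t ih =>
    intro t' s s' hs hs' h
    cases t' with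
    | nil =>
      rcases hs' with rfl | ⟨q, rfl⟩
      · simp [path] at h
      · have := t.head_path s (hd s hs)
        simp only [path, List.nil_append, List.cons_append, List.cons.injEq, true_and] at h
        simp [h] at this
    | point t' => simpa using ih t' s s' hs hs' (by simpa [path] using h)
    | arc t' => simp [path] at h
    | arcs l r => simp [path] at h
  | arc t ih =>
    intro t' s s' hs hs' h
    cases t' with
    | nil => rcases hs' with rfl | ⟨q, rfl⟩ <;> simp [path] at h
    | point t' => simp [path] at h
    | arc t' => simpa using ih t' s s' hs hs' (by simpa [path] using h)
    | arcs l r =>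
      have h1 := l.head_path (L :: D :: (r.path ++ s')) (by simp)
      simp only [path, List.cons_append, List.append_assoc, List.cons.injEq, true_and] at h
      rw [← h] at h1
      simp at h1
  | arcs l r ihl ihr =>
    intro t' s s' hs hs' h
    cases t' with
    | nil => rcases hs' with rfl | ⟨q, rfl⟩ <;> simp [path] at h
    | point t' => simp [path] at h
    | arc t' =>
      have h1 := l.head_path (L :: D :: (r.path ++ s)) (by simp)
      simp only [path, List.cons_append, List.append_assoc, List.cons.injEq, true_and] at h
      rw [h] at h1
      simp at h1
    | arcs l' r' =>
      have h1 := ihl l' (L :: D :: (r.path ++ s)) (L :: D :: (r'.path ++ s')) (by simp) (by simp)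
        (by simpa [path] using h)
      have h2 := ihr r' s s' hs hs' (by simpa using h1.2)
      simp [h1.1, h2]

/-- A path of a tree cannot end with `U`, and removing a final `L` leaves the path of a tree. -/
theorem path_last (t : FoldTree) : t = nil ∨ (∃ l : FoldTree, t.path = l.path ++ [L]) ∨
    ∃ x, t.path = x ++ [D] := by
  induction t with
  | nil => simp
  | point t ih =>
    rcases ih with rfl | ⟨l, h⟩ | ⟨x, h⟩
    · exact .inr (.inl ⟨nil, by simp [path]⟩)
    · exact .inr (.inl ⟨point l, by simp [path, h]⟩)
    · exact .inr (.inr ⟨L :: x, by simp [path, h]⟩)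
  | arc t ih =>
    rcases ih with rfl | ⟨l, h⟩ | ⟨x, h⟩
    · exact .inr (.inr ⟨[U], by simp [path]⟩)
    · exact .inr (.inl ⟨arc l, by simp [path, h]⟩)
    · exact .inr (.inr ⟨U :: D :: x, by simp [path, h]⟩)
  | arcs l t _ ih =>
    rcases ih with rfl | ⟨m, h⟩ | ⟨x, h⟩
    · exact .inr (.inr ⟨U :: (l.path ++ [L]), by simp [path]⟩)
    · exact .inr (.inl ⟨arcs l m, by simp [path, h]⟩)
    · exact .inr (.inr ⟨U :: (l.path ++ L :: D :: x), by simp [path, h]⟩)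

/-- Any word without `DD` is read as the path of a tree up to its end or up to a first step below
the `x`-axis, unless some up step is never closed. -/
theorem exists_path_aux (n : ℕ) : ∀ w : List MotzkinStep, w.length ≤ n → ¬ [D, D] <:+: w →
    (∃ (t : FoldTree) (s : List MotzkinStep), w = t.path ++ D :: s) ∨ (∃ t : FoldTree, w = t.path) ∨
      w.count D < w.count U := by
  induction n with
  | zero =>
    intro w hw _
    exact .inr (.inl ⟨nil, by simpa [path] using hw⟩)
  | succ n ih =>
    intro w hw hd
    have hsuf : ∀ x y : List MotzkinStep, w = x ++ y → ¬ [D, D] <:+: y := fun x y h hi =>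
      hd (hi.trans (h ▸ (List.suffix_append x y).isInfix))
    rcases w with _ | ⟨a, w⟩
    · exact .inr (.inl ⟨nil, rfl⟩)
    have hw' : w.length ≤ n := by simpa using hw
    cases a with
    | D => exact .inl ⟨nil, w, rfl⟩
    | L =>
      rcases ih w hw' (hsuf [L] _ rfl) with ⟨t, s, rfl⟩ | ⟨t, rfl⟩ | h
      · exact .inl ⟨point t, s, rfl⟩
      · exact .inr (.inl ⟨point t, rfl⟩)
      · exact .inr (.inr (by simpa [List.count_cons] using h))
    | U =>
      rcases ih w hw' (hsuf [U] _ rfl) with ⟨t, s, rfl⟩ | ⟨t, rfl⟩ | h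
      -- Here the first `U` is closed by `D`, and the path in between does not end with `D`.
      · have hs := ih s (by simp at hw'; omega) (hsuf (U :: t.path ++ [D]) _ (by simp))
        have ht : t = nil ∨ ∃ l : FoldTree, t.path = l.path ++ [L] := by
          rcases t.path_last with h | h | ⟨x, h⟩
          · exact .inl h
          · exact .inr h
          · exact absurd ⟨U :: x, s, by simp [h]⟩ hd
        rcases ht with rfl | ⟨l, h⟩
        · rcases hs with ⟨r, s, rfl⟩ | ⟨r, rfl⟩ | h
          · exact .inl ⟨arc r, s, by simp [path]⟩
          · exact .inr (.inl ⟨arc r, by simp [path]⟩)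
          · exact .inr (.inr (by simpa [path, List.count_cons] using h))
        · have := l.count_path
          rcases hs with ⟨r, s, rfl⟩ | ⟨r, rfl⟩ | h'
          · exact .inl ⟨arcs l r, s, by simp [path, h]⟩
          · exact .inr (.inl ⟨arcs l r, by simp [path, h]⟩)
          · exact .inr (.inr (by simp [h]; omega))
      · have := t.count_path
        exact .inr (.inr (by simp; omega))
      · exact .inr (.inr (by simp; omega))

theorem path_mem (t : FoldTree) : t.path ∈ ddFreeMotzkinPaths t.size :=
  ⟨⟨t.length_path, t.count_path, t.prefix_path⟩, by
    simpa using t.not_DD_path [] (by simp) (by simp)⟩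

theorem exists_path {n w} (h : w ∈ ddFreeMotzkinPaths n) :
    ∃ t : FoldTree, t.size = n ∧ t.path = w := by
  obtain ⟨⟨h1, h2, h3⟩, h4⟩ := h
  rcases exists_path_aux _ w le_rfl h4 with ⟨t, s, rfl⟩ | ⟨t, rfl⟩ | h
  · have := h3 (t.path ++ [D]) ⟨s, by simp⟩
    have := t.count_path
    simp at *; omega
  · exact ⟨t, by rw [← length_path, h1], rfl⟩
  · omega

theorem path_injective : Function.Injective path := fun t t' h =>
  (path_append_inj t t' [] [] (.inl rfl) (.inl rfl) (by simpa using h)).1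

theorem ncard_ddFreeMotzkinPaths (n : ℕ) :
    (ddFreeMotzkinPaths n).ncard = {t : FoldTree | t.size = n}.ncard := by
  rw [← Set.ncard_image_of_injective _ path_injective]
  congr 1
  ext w
  constructor
  · intro h
    obtain ⟨t, h1, h2⟩ := exists_path h
    exact ⟨t, h1, h2⟩
  · rintro ⟨t, rfl, rfl⟩
    exact t.path_mem

end FoldTree

/-! ### Secondary structures -/

/-- `A` is the set of arcs of a secondary structure on the `m` vertices `k, …, k + m - 1`. -/
structure IsStructureOn (k m : ℕ) (A : Finset (ℕ × ℕ)) : Prop where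
  le_fst : ∀ p ∈ A, k ≤ p.1
  gap : ∀ p ∈ A, p.1 + 1 < p.2
  snd_lt : ∀ p ∈ A, p.2 < k + m
  disjoint : ∀ p ∈ A, ∀ q ∈ A,
    (p.1 = q.1 ∨ p.1 = q.2 ∨ p.2 = q.1 ∨ p.2 = q.2) → p = q
  noncrossing : ∀ p ∈ A, ∀ q ∈ A, ¬ (p.1 < q.1 ∧ q.1 < p.2 ∧ p.2 < q.2)

theorem isStructureOn_one_iff {m A} : IsStructureOn 1 m A ↔ IsSecondaryStructure m A :=
  ⟨fun ⟨h1, h2, h3, h4, h5⟩ => ⟨h1, h2, fun p hp => by have := h3 p hp; omega, h4, h5⟩,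
   fun ⟨h1, h2, h3, h4, h5⟩ => ⟨h1, h2, fun p hp => by have := h3 p hp; omega, h4, h5⟩⟩

namespace FoldTree

/-- The arcs of the secondary structure on `size + 1` vertices starting at `k` given by a tree:
`nil` is a single vertex, `point t` a free vertex followed by `t`, `arc l` an arc around `l`, and
`arcs l r` an arc around `l` followed by `r`. -/
def bonds : ℕ → FoldTree → Finset (ℕ × ℕ)
  | _, nil => ∅
  | k, point t => bonds (k + 1) t
  | k, arc l => insert (k, k + l.size + 2) (bonds (k + 1) l)
  | k, arcs l r => insert (k, k + l.size + 2) (bonds (k + 1) l ∪ bonds (k + l.size + 3) r)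

theorem isStructureOn_bonds (t : FoldTree) : ∀ k, IsStructureOn k (t.size + 1) (bonds k t) := by
  induction t with
  | nil => intro k; constructor <;> simp [bonds]
  | point t ih =>
    intro k
    obtain ⟨h1, h2, h3, h4, h5⟩ := ih (k + 1)
    exact ⟨fun p hp => by have := h1 p hp; omega, h2,
      fun p hp => by have := h3 p hp; simp only [size]; omega, h4, h5⟩
  | arc l ih =>
    intro k
    obtain ⟨h1, h2, h3, h4, h5⟩ := ih (k + 1)
    constructor
    · simp only [bonds, Finset.mem_insert]
      rintro p (rfl | hp)
      · simp
      · have := h1 p hp; omega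
    · simp only [bonds, Finset.mem_insert]
      rintro p (rfl | hp)
      · simp
      · exact h2 p hp
    · simp only [bonds, size, Finset.mem_insert]
      rintro p (rfl | hp)
      · simp; omega
      · have := h3 p hp; omega
    · simp only [bonds, Finset.mem_insert]
      rintro p (rfl | hp) q (rfl | hq)
      · simp
      · have := h1 q hq; have := h2 q hq; have := h3 q hq; simp; omega
      · have := h1 p hp; have := h2 p hp; have := h3 p hp; simp; omega
      · exact h4 p hp q hq
    · simp only [bonds, Finset.mem_insert]
      rintro p (rfl | hp) q (rfl | hq)
      · simp
      · have := h1 q hq; have := h2 q hq; have := h3 q hq; simp; omega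
      · have := h1 p hp; have := h2 p hp; have := h3 p hp; simp; omega
      · exact h5 p hp q hq
  | arcs l r ihl ihr =>
    intro k
    obtain ⟨h1, h2, h3, h4, h5⟩ := ihl (k + 1)
    obtain ⟨g1, g2, g3, g4, g5⟩ := ihr (k + l.size + 3)
    constructor
    · simp only [bonds, Finset.mem_insert, Finset.mem_union]
      rintro p (rfl | hp | hp)
      · simp
      · have := h1 p hp; omega
      · have := g1 p hp; omega
    · simp only [bonds, Finset.mem_insert, Finset.mem_union]
      rintro p (rfl | hp | hp)
      · simp
      · exact h2 p hp
      · exact g2 p hp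
    · simp only [bonds, size, Finset.mem_insert, Finset.mem_union]
      rintro p (rfl | hp | hp)
      · simp; omega
      · have := h3 p hp; omega
      · have := g3 p hp; omega
    · simp only [bonds, Finset.mem_insert, Finset.mem_union]
      rintro p (rfl | hp | hp) q (rfl | hq | hq)
      · simp
      · have := h1 q hq; have := h2 q hq; have := h3 q hq; simp; omega
      · have := g1 q hq; have := g2 q hq; have := g3 q hq; simp; omega
      · have := h1 p hp; have := h2 p hp; have := h3 p hp; simp; omega
      · exact h4 p hp q hq
      · have := h2 p hp; have := h3 p hp; have := g1 q hq; have := g2 q hq; omega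
      · have := g1 p hp; have := g2 p hp; have := g3 p hp; simp; omega
      · have := h2 q hq; have := h3 q hq; have := g1 p hp; have := g2 p hp; omega
      · exact g4 p hp q hq
    · simp only [bonds, Finset.mem_insert, Finset.mem_union]
      rintro p (rfl | hp | hp) q (rfl | hq | hq)
      · simp
      · have := h1 q hq; have := h2 q hq; have := h3 q hq; simp; omega
      · have := g1 q hq; have := g2 q hq; have := g3 q hq; simp; omega
      · have := h1 p hp; have := h2 p hp; have := h3 p hp; simp; omega
      · exact h5 p hp q hq
      · have := h2 p hp; have := h3 p hp; have := g1 q hq; have := g2 q hq; omega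
      · have := g1 p hp; have := g2 p hp; have := g3 p hp; simp; omega
      · have := h2 q hq; have := h3 q hq; have := g1 p hp; have := g2 p hp; omega
      · exact g5 p hp q hq

/-- If the first vertex is joined to `j`, then the other arcs lie strictly inside `(k, j)` or beyond
`j`; otherwise the first vertex may be dropped. -/
theorem exists_bonds (n : ℕ) : ∀ k A, IsStructureOn k (n + 1) A → ∃ t : FoldTree, t.size = n ∧
    bonds k t = A := by
  induction n using Nat.strong_induction_on with
  | _ n ih =>
  intro k A h
  obtain ⟨h1, h2, h3, h4, h5⟩ := h
  by_cases hk : ∃ j, (k, j) ∈ A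
  · obtain ⟨j, hj⟩ := hk
    have hj2 := h2 _ hj
    have hj3 := h3 _ hj
    simp only at hj2 hj3
    obtain ⟨i, rfl⟩ : ∃ i, j = k + i + 2 := ⟨j - k - 2, by omega⟩
    have hl : IsStructureOn (k + 1) (i + 1) (A.filter fun p => k < p.1 ∧ p.2 < k + i + 2) := by
      constructor
      · intro p hp; simp only [Finset.mem_filter] at hp; omega
      · intro p hp; simp only [Finset.mem_filter] at hp; exact h2 p hp.1
      · intro p hp; simp only [Finset.mem_filter] at hp; omega
      · intro p hp q hq; simp only [Finset.mem_filter] at hp hq; exact h4 p hp.1 q hq.1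
      · intro p hp q hq; simp only [Finset.mem_filter] at hp hq; exact h5 p hp.1 q hq.1
    obtain ⟨l, hl1, hl2⟩ := ih i (by omega) _ _ hl
    have hcases : ∀ p ∈ A, p = (k, k + i + 2) ∨ (k < p.1 ∧ p.2 < k + i + 2) ∨ k + i + 2 < p.1 := by
      intro p hp
      by_cases hpe : p = (k, k + i + 2)
      · exact .inl hpe
      have := h1 p hp; have := h2 p hp; have := h5 _ hj p hp
      have h4' := h4 p hp _ hj
      simp only [hpe, imp_false] at h4'
      simp only at this
      omega
    by_cases hn : n = i + 2
    · refine ⟨arc l, by simp [size, hl1, hn], ?_⟩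
      simp only [bonds, hl1, hl2]
      ext p
      simp only [Finset.mem_insert, Finset.mem_filter]
      constructor
      · rintro (rfl | hp)
        · exact hj
        · exact hp.1
      · intro hp
        have := h2 p hp; have := h3 p hp
        rcases hcases p hp with h | h | h
        · exact .inl h
        · exact .inr ⟨hp, h⟩
        · omega
    · obtain ⟨m, rfl⟩ : ∃ m, n = i + m + 3 := ⟨n - i - 3, by omega⟩
      have hr : IsStructureOn (k + i + 3) (m + 1) (A.filter fun p => k + i + 2 < p.1) := by
        constructor
        · intro p hp; simp only [Finset.mem_filter] at hp; omega
        · intro p hp; simp only [Finset.mem_filter] at hp; exact h2 p hp.1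
        · intro p hp; simp only [Finset.mem_filter] at hp; have := h3 p hp.1; omega
        · intro p hp q hq; simp only [Finset.mem_filter] at hp hq; exact h4 p hp.1 q hq.1
        · intro p hp q hq; simp only [Finset.mem_filter] at hp hq; exact h5 p hp.1 q hq.1
      obtain ⟨r, hr1, hr2⟩ := ih m (by omega) _ _ hr
      refine ⟨arcs l r, by simp [size, hl1, hr1], ?_⟩
      simp only [bonds, hl1, hl2, hr2]
      ext p
      simp only [Finset.mem_insert, Finset.mem_filter, Finset.mem_union]
      constructor
      · rintro (rfl | hp | hp)
        · exact hj
        · exact hp.1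
        · exact hp.1
      · intro hp
        rcases hcases p hp with h | h | h
        · exact .inl h
        · exact .inr (.inl ⟨hp, h⟩)
        · exact .inr (.inr ⟨hp, h⟩)
  · push Not at hk
    rcases n with _ | n
    · refine ⟨nil, rfl, ?_⟩
      simp only [bonds]
      symm
      rw [Finset.eq_empty_iff_forall_notMem]
      intro p hp
      have := h1 p hp; have := h2 p hp; have := h3 p hp
      omega
    · obtain ⟨t, ht1, ht2⟩ := ih n (by omega) (k + 1) A
        ⟨fun p hp => by
          have := h1 p hp
          rcases this.eq_or_lt with h | h
          · exact absurd (by rw [h]; exact hp) (hk p.2)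
          · omega, h2, fun p hp => by have := h3 p hp; omega, h4, h5⟩
      exact ⟨point t, by simp [size, ht1], ht2⟩

/-- The arc at the first vertex, if any, determines the root of the tree and the sizes of the
subtrees. The size must be given, as it is not determined by the arcs. -/
theorem bonds_injective (t : FoldTree) : ∀ (t' : FoldTree) (k : ℕ), t.size = t'.size →
    bonds k t = bonds k t' → t = t' := by
  have hout : ∀ k j (t : FoldTree), (k, j) ∉ bonds (k + 1) t := fun k j t h => by
    have := (t.isStructureOn_bonds (k + 1)).le_fst _ h
    simp at this
  have hin : ∀ k (l : FoldTree), (bonds k (arc l)).filter (fun p => k < p.1) = bonds (k + 1) l := by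
    intro k l
    ext p
    simp only [bonds, Finset.mem_filter, Finset.mem_insert]
    constructor
    · rintro ⟨rfl | h, h'⟩
      · simp at h'
      · exact h
    · intro h
      have := (l.isStructureOn_bonds (k + 1)).le_fst _ h
      exact ⟨.inr h, this⟩
  have hleft : ∀ k (l r : FoldTree), (bonds k (arcs l r)).filter
      (fun p => k < p.1 ∧ p.2 < k + l.size + 2) = bonds (k + 1) l := by
    intro k l r
    ext p
    simp only [bonds, Finset.mem_filter, Finset.mem_insert, Finset.mem_union]
    constructor
    · rintro ⟨rfl | h | h, h'⟩
      · simp at h'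
      · exact h
      · have := (r.isStructureOn_bonds (k + l.size + 3)).le_fst _ h
        have := (r.isStructureOn_bonds (k + l.size + 3)).gap _ h
        omega
    · intro h
      have := (l.isStructureOn_bonds (k + 1)).le_fst _ h
      have := (l.isStructureOn_bonds (k + 1)).snd_lt _ h
      exact ⟨.inr (.inl h), by omega, by omega⟩
  have hright : ∀ k (l r : FoldTree), (bonds k (arcs l r)).filter
      (fun p => k + l.size + 2 < p.1) = bonds (k + l.size + 3) r := by
    intro k l r
    ext p
    simp only [bonds, Finset.mem_filter, Finset.mem_insert, Finset.mem_union]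
    constructor
    · rintro ⟨rfl | h | h, h'⟩
      · simp at h'; omega
      · have := (l.isStructureOn_bonds (k + 1)).snd_lt _ h
        have := (l.isStructureOn_bonds (k + 1)).gap _ h
        omega
      · exact h
    · intro h
      have := (r.isStructureOn_bonds (k + l.size + 3)).le_fst _ h
      exact ⟨.inr (.inr h), by omega⟩
  have hfirst : ∀ k j (l r : FoldTree), (k, j) ∈ bonds k (arcs l r) → j = k + l.size + 2 := by
    intro k j l r h
    simp only [bonds, Finset.mem_insert, Finset.mem_union, Prod.mk.injEq, true_and] at h
    rcases h with h | h | h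
    · exact h
    · exact absurd h (hout _ _ _)
    · have := (r.isStructureOn_bonds (k + l.size + 3)).le_fst _ h
      simp only at this; omega
  have harc : ∀ k j (l : FoldTree), (k, j) ∈ bonds k (arc l) → j = k + l.size + 2 := by
    intro k j l h
    simp only [bonds, Finset.mem_insert, Prod.mk.injEq, true_and] at h
    rcases h with h | h
    · exact h
    · exact absurd h (hout _ _ _)
  have marc : ∀ k (l : FoldTree), (k, k + l.size + 2) ∈ bonds k (arc l) := by simp [bonds]
  have marcs : ∀ k (l r : FoldTree), (k, k + l.size + 2) ∈ bonds k (arcs l r) := by simp [bonds]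
  induction t with
  | nil =>
    intro t' k hs _
    cases t' <;> simp_all [size]
  | point t ih =>
    intro t' k hs h
    cases t' with
    | nil => simp [size] at hs
    | point t' => rw [ih t' (k + 1) (by simpa [size] using hs) h]
    | arc l => exact absurd (h ▸ marc k l) (hout _ _ t)
    | arcs l r => exact absurd (h ▸ marcs k l r) (hout _ _ t)
  | arc l ih =>
    intro t' k hs h
    cases t' with
    | nil => simp [size] at hs
    | point t' => exact absurd (h ▸ marc k l) (hout _ _ t')
    | arc l' => rw [ih l' (k + 1) (by simpa [size] using hs) (by rw [← hin, h, hin])]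
    | arcs l' r' =>
      have := hfirst _ _ _ _ (h ▸ marc k l)
      simp only [size] at hs; omega
  | arcs l r ihl ihr =>
    intro t' k hs h
    cases t' with
    | nil => simp [size] at hs
    | point t' => exact absurd (h ▸ marcs k l r) (hout _ _ t')
    | arc l' =>
      have := harc _ _ _ (h ▸ marcs k l r)
      simp only [size] at hs; omega
    | arcs l' r' =>
      have hl := hfirst _ _ _ _ (h ▸ marcs k l r)
      have hl : l.size = l'.size := by omega
      simp only [size] at hs
      rw [ihl l' (k + 1) hl (by rw [← hleft _ _ r, h, hl, hleft]),
        ihr r' (k + l.size + 3) (by omega) (by rw [← hright, h, hl, hright])]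

theorem secondaryStructureNumber_eq (n : ℕ) :
    secondaryStructureNumber n = {t : FoldTree | t.size = n}.ncard := by
  have hinj : Set.InjOn (bonds 1) {t : FoldTree | t.size = n} := fun t ht t' ht' h =>
    bonds_injective t t' 1 (ht.trans ht'.symm) h
  rw [secondaryStructureNumber, ← hinj.ncard_image]
  congr 1
  ext A
  rw [Set.mem_ofPred, ← isStructureOn_one_iff]
  constructor
  · intro h
    obtain ⟨t, h1, h2⟩ := exists_bonds n 1 A h
    exact ⟨t, h1, h2⟩
  · rintro ⟨t, rfl, rfl⟩
    exact t.isStructureOn_bonds 1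

end FoldTree

/-! ### Counting trees -/

namespace FoldTree

theorem size_eq_zero : {t : FoldTree | t.size = 0} = {nil} := by
  ext t; cases t <;> simp [size]

theorem size_eq_one : {t : FoldTree | t.size = 1} = {point nil} := by
  ext t
  rcases t with _ | t | t | ⟨l, r⟩ <;> simp [size]
  cases t <;> simp [size]

theorem size_eq_two : {t : FoldTree | t.size = 2} = {point (point nil), arc nil} := by
  ext t
  rcases t with _ | t | t | ⟨l, r⟩ <;> simp [size]
  · rcases t with _ | t | t | ⟨l, r⟩ <;> simp [size]
    cases t <;> simp [size]
  · cases t <;> simp [size]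

theorem size_eq_add_three (n : ℕ) : {t : FoldTree | t.size = n + 3} =
    (point '' {t | t.size = n + 2} ∪ arc '' {t | t.size = n + 1}) ∪
      ⋃ p ∈ (Finset.HasAntidiagonal.antidiagonal n : Set (ℕ × ℕ)),
        (fun q : FoldTree × FoldTree => arcs q.1 q.2) ''
          ({t | t.size = p.1} ×ˢ {t | t.size = p.2}) := by
  ext t
  rcases t with _ | t | t | ⟨l, r⟩ <;> simp [size]

theorem finite_size (n : ℕ) : {t : FoldTree | t.size = n}.Finite := by
  induction n using Nat.strong_induction_on with
  | _ n ih =>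
  match n, ih with
  | 0, _ => simp [size_eq_zero]
  | 1, _ => simp [size_eq_one]
  | 2, _ => simp [size_eq_two]
  | n + 3, ih =>
    rw [size_eq_add_three]
    refine (((ih _ (by omega)).image _).union ((ih _ (by omega)).image _)).union
      (Set.Finite.biUnion (Finset.finite_toSet _) fun p hp => ?_)
    have : p.1 + p.2 = n := by simpa using hp
    exact ((ih _ (by omega)).prod (ih _ (by omega))).image _

open Finset in
theorem ncard_size_add_three (n : ℕ) : {t : FoldTree | t.size = n + 3}.ncard =
    {t : FoldTree | t.size = n + 2}.ncard + {t : FoldTree | t.size = n + 1}.ncard +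
      ∑ p ∈ antidiagonal n,
        {t : FoldTree | t.size = p.1}.ncard * {t : FoldTree | t.size = p.2}.ncard := by
  have hinj : Function.Injective (fun q : FoldTree × FoldTree => arcs q.1 q.2) := by
    rintro ⟨a, b⟩ ⟨c, d⟩ h; simpa using h
  have hfin : ∀ p : ℕ × ℕ, ((fun q : FoldTree × FoldTree => arcs q.1 q.2) ''
      ({t | t.size = p.1} ×ˢ {t | t.size = p.2})).Finite :=
    fun p => ((finite_size _).prod (finite_size _)).image _
  have hfin₀ := (finite_size (n + 2)).image point
  have hfin₁ := (finite_size (n + 1)).image arc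
  have hdisj₀ : Disjoint (point '' {t | t.size = n + 2}) (arc '' {t | t.size = n + 1}) := by
    rw [Set.disjoint_left]
    rintro _ ⟨a, -, rfl⟩ ⟨b, -, h⟩
    simp at h
  have hdisj : Disjoint (point '' {t | t.size = n + 2} ∪ arc '' {t | t.size = n + 1})
      (⋃ p ∈ (HasAntidiagonal.antidiagonal n : Set (ℕ × ℕ)),
        (fun q : FoldTree × FoldTree => arcs q.1 q.2) ''
          ({t | t.size = p.1} ×ˢ {t | t.size = p.2})) := by
    rw [Set.disjoint_left]
    rintro _ (⟨a, -, rfl⟩ | ⟨a, -, rfl⟩) h <;> simp at h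
  have hdisj₂ : (HasAntidiagonal.antidiagonal n : Set (ℕ × ℕ)).PairwiseDisjoint fun p =>
      (fun q : FoldTree × FoldTree => arcs q.1 q.2) ''
        ({t | t.size = p.1} ×ˢ {t | t.size = p.2}) := by
    rintro p - q - hpq
    simp only [Function.onFun]
    rw [Set.disjoint_left]
    rintro _ ⟨⟨a, b⟩, ⟨h1, h2⟩, rfl⟩ ⟨⟨c, d⟩, ⟨h3, h4⟩, h⟩
    simp only [arcs.injEq, Set.mem_ofPred_eq] at h h1 h2 h3 h4
    exact hpq (Prod.ext (by rw [← h1, ← h3, h.1]) (by rw [← h2, ← h4, h.2]))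
  rw [size_eq_add_three, Set.ncard_union_eq hdisj (hfin₀.union hfin₁)
      (Set.Finite.biUnion (Finset.finite_toSet _) fun p _ => hfin p),
    Set.ncard_union_eq hdisj₀ hfin₀ hfin₁,
    Set.ncard_image_of_injective _ fun _ _ h => by simpa using h,
    Set.ncard_image_of_injective _ fun _ _ h => by simpa using h,
    (Finset.finite_toSet _).ncard_biUnion (fun p _ => hfin p) hdisj₂, finsum_mem_coe_finset]
  simp_rw [Set.ncard_image_of_injective _ hinj, Set.ncard_prod]

end FoldTree

/-! ### Factorization around the least letter -/

/-- `f` is a permutation of `{0, …, n - 1}`, extended by `0`, that avoids `213`,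
has no double descent, and whose inverse has no double descent: no values `v + 2, v + 1, v` occur
in this order. -/
structure Admissible (n : ℕ) (f : ℕ → ℕ) : Prop where
  lt : ∀ i < n, f i < n
  inj : ∀ i < n, ∀ j < n, f i = f j → i = j
  zero : ∀ i, n ≤ i → f i = 0
  avoid : ∀ i j k, i < j → j < k → k < n → f j < f i → ¬ f i < f k
  noDescent : ∀ i, i + 2 < n → f (i + 1) < f i → ¬ f (i + 2) < f (i + 1)
  noInvDescent : ∀ i j k, i < j → j < k → k < n → f j = f k + 1 → f i ≠ f k + 2

/-- The word `f 0, …, f (n - 1)` does not end with a descent. -/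
def EndsUp (n : ℕ) (f : ℕ → ℕ) : Prop := ∀ i, i + 2 = n → f i < f (i + 1)

/-- The value `n - 2` occurs before the value `n - 1`. -/
def TopUp (n : ℕ) (f : ℕ → ℕ) : Prop :=
  ∀ i < n, ∀ j < n, f i + 2 = n → f j + 1 = n → i < j

/-- The word `A 0 B`, where `A` has length `a` and is raised above all of `0 B`, and `B` has
length `b`. -/
def glue (a b : ℕ) (A B : ℕ → ℕ) (i : ℕ) : ℕ :=
  if i < a then A i + (b + 1) else if i = a then 0 else
    if i < a + b + 1 then B (i - (a + 1)) + 1 else 0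

/-- The part before position `a` of a word of length `a + b + 1`, lowered to start at `0`. -/
def leftPart (a b : ℕ) (f : ℕ → ℕ) (i : ℕ) : ℕ := if i < a then f i - (b + 1) else 0

/-- The part after position `a` of a word of length `a + b + 1`, lowered to start at `0`. -/
def rightPart (a b : ℕ) (f : ℕ → ℕ) (i : ℕ) : ℕ := if i < b then f (a + 1 + i) - 1 else 0

theorem Admissible.surj {n f} (h : Admissible n f) : ∀ v < n, ∃ i < n, f i = v := by
  intro v hv
  have := Finset.surj_on_of_inj_on_of_card_le (s := Finset.range n) (t := Finset.range n)
    (fun i _ => f i) (fun i hi => by simpa using h.lt i (by simpa using hi))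
    (fun i j hi hj hij => h.inj i (by simpa using hi) j (by simpa using hj) hij) le_rfl v
    (by simpa using hv)
  obtain ⟨i, hi, e⟩ := this
  exact ⟨i, by simpa using hi, e.symm⟩

section glue

variable {a b : ℕ} {A B : ℕ → ℕ}

theorem glue_left {i} (h : i < a) : glue a b A B i = A i + (b + 1) := by simp [glue, h]

theorem glue_mid : glue a b A B a = 0 := by simp [glue]

theorem glue_right {i} (h : i < b) : glue a b A B (a + 1 + i) = B i + 1 := by
  unfold glue
  rw [if_neg (by omega), if_neg (by omega), if_pos (by omega)]
  congr 2; omega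

theorem glue_out {i} (h : a + b + 1 ≤ i) : glue a b A B i = 0 := by
  unfold glue
  rw [if_neg (by omega), if_neg (by omega), if_neg (by omega)]

theorem glue_cases (i : ℕ) :
    (i < a ∧ glue a b A B i = A i + (b + 1)) ∨
    (i = a ∧ glue a b A B i = 0) ∨
    (∃ j < b, i = a + 1 + j ∧ glue a b A B i = B j + 1) ∨ (a + b + 1 ≤ i ∧ glue a b A B i = 0) := by
  rcases lt_trichotomy i a with h | h | h
  · exact .inl ⟨h, glue_left h⟩
  · subst h; exact .inr (.inl ⟨rfl, glue_mid⟩)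
  · by_cases h2 : i < a + b + 1
    · refine .inr (.inr (.inl ⟨i - (a+1), by omega, by omega, ?_⟩))
      rw [← glue_right (a := a) (A := A) (B := B) (by omega : i - (a+1) < b)]; congr 1; omega
    · exact .inr (.inr (.inr ⟨by omega, glue_out (by omega)⟩))

/-- A last letter after `1 … 0` would complete a `213`, so `0` would be last, below its
predecessor. -/
theorem Admissible.zero_before_one (hA : Admissible a A) (hu : EndsUp a A)
    {i j : ℕ} (hi : i < a) (hj : j < a) (h1 : A i = 1) (h0 : A j = 0) : j < i := by
  by_contra hc
  have hij : i < j := by grind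
  obtain ⟨m, rfl⟩ : ∃ m, a = m + 2 := ⟨a - 2, by omega⟩
  have h := hu m rfl
  have : j ≠ m + 1 := by rintro rfl; omega
  have h3 := hA.avoid i j (m+1) hij (by omega) (by omega) (by omega)
  have h4 := hA.inj i (by omega) (m+1) (by omega)
  have h5 := hA.inj j (by omega) (m+1) (by omega)
  omega

theorem Admissible.glue (hA : Admissible a A) (hB : Admissible b B) (hu : EndsUp a A)
    (ht : a ≠ 0 → TopUp b B) : Admissible (a + b + 1) (glue a b A B) where
  lt i hi := by
    have := hA.lt; have := hB.lt
    rcases glue_cases (A := A) (B := B) (a := a) (b := b) i with h | h | h | h <;> grind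
  inj i hi j hj := by
    have := hA.inj; have := hB.inj; have := hA.lt; have := hB.lt
    rcases glue_cases (A := A) (B := B) (a := a) (b := b) i with h | h | h | h <;>
    rcases glue_cases (A := A) (B := B) (a := a) (b := b) j with h' | h' | h' | h' <;> grind
  zero i hi := glue_out hi
  avoid i j k hij hjk hk := by
    have := hB.lt
    rcases glue_cases (A := A) (B := B) (a := a) (b := b) i with h | h | ⟨i', h⟩ | h <;>
    rcases glue_cases (A := A) (B := B) (a := a) (b := b) j with h' | h' | ⟨j', h'⟩ | h' <;>
    rcases glue_cases (A := A) (B := B) (a := a) (b := b) k with h'' | h'' | ⟨k', h''⟩ | h'' <;>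
    try omega
    · have := hA.avoid i j k; omega
    · have := this k'; omega
    · have := this k'; omega
    · have := this k'; omega
    · have := hB.avoid i' j' k'; omega
  noDescent i hi := by
    have := hB.lt
    rcases glue_cases (A := A) (B := B) (a := a) (b := b) i with h | h | ⟨i', h⟩ | h <;>
    rcases glue_cases (A := A) (B := B) (a := a) (b := b) (i+1) with h' | h' | ⟨j', h'⟩ | h' <;>
    rcases glue_cases (A := A) (B := B) (a := a) (b := b) (i+2) with h'' | h'' | ⟨k', h''⟩ | h'' <;>
    try omega
    · have := hA.noDescent i; omega
    · have := hu i; omega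
    · obtain rfl : j' = i' + 1 := by omega
      obtain rfl : k' = i' + 2 := by omega
      have := hB.noDescent i'; omega
  noInvDescent i j k hij hjk hk := by
    have := hB.lt
    rcases glue_cases (A := A) (B := B) (a := a) (b := b) i with h | h | ⟨i', h⟩ | h <;>
    rcases glue_cases (A := A) (B := B) (a := a) (b := b) j with h' | h' | ⟨j', h'⟩ | h' <;>
    rcases glue_cases (A := A) (B := B) (a := a) (b := b) k with h'' | h'' | ⟨k', h''⟩ | h'' <;>
    try omega
    · have := hA.noInvDescent i j k; omega
    -- `v` in `0 B` and `v + 1, v + 2` in `A`, being the two least letters of `A`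
    · have := hA.zero_before_one hu (i := i) (j := j); omega
    · have := hA.zero_before_one hu (i := i) (j := j); have := hB.lt k'; omega
    -- `v, v + 1` in `B`, its two largest letters, and `v + 2` in `A`
    · have := ht (by omega) k' (by omega) j' (by omega)
      have := hB.lt j'
      omega
    · have := hB.noInvDescent i' j' k'; omega

end glue

section split

variable {a b : ℕ} {f : ℕ → ℕ}

theorem Admissible.lt_left (h : Admissible (a + b + 1) f) (h0 : f a = 0)
    {i j : ℕ} (hi : i < a) (hj : a ≤ j) (hj' : j < a + b + 1) : f j < f i := by
  have h1 := h.inj i (by omega) a (by omega)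
  have h2 := h.inj i (by omega) j (by omega)
  rcases hj.eq_or_lt with rfl | hj
  · omega
  · have := h.avoid i a j hi hj hj'
    omega

/-- All `b + 1` letters from position `a` on are below each letter of the left part. -/
theorem Admissible.le_left (h : Admissible (a + b + 1) f) (h0 : f a = 0) {i : ℕ} (hi : i < a) :
    b + 1 ≤ f i := by
  have := Finset.card_le_card_of_injOn (s := Finset.Ico a (a + b + 1)) (t := Finset.range (f i)) f
    (fun j hj => by
      simp only [Finset.coe_Ico, Set.mem_Ico] at hj
      simpa using h.lt_left h0 hi hj.1 hj.2)
    (fun j hj k hk => by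
      simp only [Finset.coe_Ico, Set.mem_Ico] at hj hk
      exact h.inj j hj.2 k hk.2)
  simp at this; omega

theorem Admissible.right_le (h : Admissible (a + b + 1) f) (h0 : f a = 0) {j : ℕ} (hj : a ≤ j)
    (hj' : j < a + b + 1) : f j ≤ b := by
  have hcard := Finset.card_le_card_of_injOn (s := Finset.range a)
    (t := Finset.Ioo (f j) (a + b + 1)) f
    (fun i hi => by
      simp only [Finset.coe_range, Set.mem_Iio] at hi
      rw [Finset.coe_Ioo, Set.mem_Ioo]; exact ⟨h.lt_left h0 hi hj hj', h.lt i (by omega)⟩)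
    (fun i hi k hk => by
      simp only [Finset.coe_range, Set.mem_Iio] at hi hk
      exact h.inj i (by omega) k (by omega))
  have := h.lt j hj'
  simp only [Finset.card_range, Nat.card_Ioo] at hcard; omega

theorem Admissible.right_pos (h : Admissible (a + b + 1) f) (h0 : f a = 0) {j : ℕ} (hj : a < j)
    (hj' : j < a + b + 1) : 0 < f j := by
  have := h.inj a (by omega) j hj'
  omega

theorem leftPart_eq (h : Admissible (a + b + 1) f) (h0 : f a = 0) {i : ℕ} (hi : i < a) :
    leftPart a b f i + (b + 1) = f i := by
  have := h.le_left h0 hi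
  simp [leftPart, hi]; omega

theorem rightPart_eq (h : Admissible (a + b + 1) f) (h0 : f a = 0) {i : ℕ} (hi : i < b) :
    rightPart a b f i + 1 = f (a + 1 + i) := by
  have := h.right_pos h0 (j := a + 1 + i) (by omega) (by omega)
  simp [rightPart, hi]; omega

theorem Admissible.leftPart (h : Admissible (a + b + 1) f) (h0 : f a = 0) :
    Admissible a (leftPart a b f) where
  lt i hi := by have := leftPart_eq h h0 hi; have := h.lt i; omega
  inj i hi j hj := by
    have := leftPart_eq h h0 hi; have := leftPart_eq h h0 hj; have := h.inj i (by omega) j; omega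
  zero i hi := by simp [_root_.leftPart]; omega
  avoid i j k hij hjk hk := by
    have := leftPart_eq h h0 hk; have := leftPart_eq h h0 (hjk.trans hk)
    have := leftPart_eq h h0 (hij.trans (hjk.trans hk)); have := h.avoid i j k hij hjk; omega
  noDescent i hi := by
    have := leftPart_eq h h0 hi; have := leftPart_eq h h0 (by omega : i < a)
    have := leftPart_eq h h0 (by omega : i + 1 < a); have := h.noDescent i; omega
  noInvDescent i j k hij hjk hk := by
    have := leftPart_eq h h0 hk; have := leftPart_eq h h0 (hjk.trans hk)
    have := leftPart_eq h h0 (hij.trans (hjk.trans hk)); have := h.noInvDescent i j k hij hjk; omega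

theorem Admissible.rightPart (h : Admissible (a + b + 1) f) (h0 : f a = 0) :
    Admissible b (rightPart a b f) where
  lt i hi := by
    have := rightPart_eq h h0 hi
    have := h.right_le h0 (j := a + 1 + i) (by omega) (by omega); omega
  inj i hi j hj := by
    have := rightPart_eq h h0 hi; have := rightPart_eq h h0 hj
    have := h.inj (a+1+i) (by omega) (a+1+j) (by omega); omega
  zero i hi := by simp [_root_.rightPart]; omega
  avoid i j k hij hjk hk := by
    have := rightPart_eq h h0 hk; have := rightPart_eq h h0 (hjk.trans hk)
    have := rightPart_eq h h0 (hij.trans (hjk.trans hk))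
    have := h.avoid (a+1+i) (a+1+j) (a+1+k); omega
  noDescent i hi := by
    have := rightPart_eq h h0 hi; have := rightPart_eq h h0 (by omega : i < b)
    have := rightPart_eq h h0 (by omega : i + 1 < b); have := h.noDescent (a+1+i)
    simp only [← add_assoc] at *; omega
  noInvDescent i j k hij hjk hk := by
    have := rightPart_eq h h0 hk; have := rightPart_eq h h0 (hjk.trans hk)
    have := rightPart_eq h h0 (hij.trans (hjk.trans hk))
    have := h.noInvDescent (a+1+i) (a+1+j) (a+1+k); omega

/-- A final descent of the left part would form a double descent with the least letter. -/
theorem Admissible.endsUp_leftPart (h : Admissible (a + b + 1) f) (h0 : f a = 0) :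
    EndsUp a (_root_.leftPart a b f) := by
  rintro i rfl
  have := leftPart_eq h h0 (by omega : i < i + 2)
  have := leftPart_eq h h0 (by omega : i + 1 < i + 2)
  have := h.inj i (by omega) (i+1) (by omega)
  have := h.noDescent i (by omega); omega

/-- The value `b + 1` lies in the nonempty left part, so the values `b` and `b - 1` on its right
cannot appear in this order. -/
theorem Admissible.topUp_rightPart (h : Admissible (a + b + 1) f) (h0 : f a = 0) (ha : a ≠ 0) :
    TopUp b (_root_.rightPart a b f) := by
  intro i hi j hj h1 h2
  have := rightPart_eq h h0 hi
  have := rightPart_eq h h0 hj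
  obtain ⟨l, hl, e⟩ := h.surj (b + 1) (by omega)
  have hla : l < a := by
    by_contra hc
    have := h.right_le h0 (j := l) (by omega) (by omega)
    omega
  have := h.noInvDescent l (a+1+j) (a+1+i) (by omega)
  have : i ≠ j := by rintro rfl; omega
  omega

theorem glue_leftPart_rightPart (h : Admissible (a + b + 1) f) (h0 : f a = 0) :
    glue a b (leftPart a b f) (rightPart a b f) = f := by
  funext i
  rcases glue_cases (A := leftPart a b f) (B := rightPart a b f) (a := a) (b := b) i with
    ⟨h1, h2⟩ | ⟨rfl, h2⟩ | ⟨j, hj, rfl, h2⟩ | ⟨h1, h2⟩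
  · rw [h2, leftPart_eq h h0 h1]
  · rw [h2, h0]
  · rw [h2, rightPart_eq h h0 hj]
  · rw [h2, h.zero i h1]

theorem glue_inj {A B A' B' : ℕ → ℕ} (hA : Admissible a A) (hB : Admissible b B)
    (hA' : Admissible a A') (hB' : Admissible b B') (h : glue a b A B = glue a b A' B') :
    A = A' ∧ B = B' := by
  constructor <;> funext i
  · by_cases hi : i < a
    · have := congrFun h i
      rw [glue_left hi, glue_left hi] at this; omega
    · rw [hA.zero i (by omega), hA'.zero i (by omega)]
  · by_cases hi : i < b
    · have := congrFun h (a + 1 + i)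
      rw [glue_right hi, glue_right hi] at this; omega
    · rw [hB.zero i (by omega), hB'.zero i (by omega)]

end split

/-! ### Doubling the last letter -/

section dup

variable {n : ℕ} {f g : ℕ → ℕ}

/-- The word of length `n + 2` obtained from `f` of length `n + 1` by replacing the last letter
`x` by `x, x + 1` and raising the letters above `x`. -/
def dupLast (n : ℕ) (f : ℕ → ℕ) (i : ℕ) : ℕ :=
  if i = n + 1 then f n + 1 else if f n < f i then f i + 1 else f i

/-- The word of length `n + 1` obtained from `f` of length `n + 2` by dropping the last letter,
to be applied when this letter is the successor of the one before it. -/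
def dropLast (n : ℕ) (f : ℕ → ℕ) (i : ℕ) : ℕ :=
  if n < i then 0 else if f n < f i then f i - 1 else f i

/-- The new value `x + 1` comes last, right after `x`: a double descent can not use it, and it could
only be the least value of an inverse double descent `x + 3, x + 2, x + 1`, in which `x` would give
one of `f`. -/
theorem Admissible.dupLast (h : Admissible (n + 1) f) : Admissible (n + 2) (dupLast n f) where
  lt i hi := by
    have := h.lt i; have := h.lt n; unfold _root_.dupLast; split_ifs <;> omega
  inj i hi j hj := by
    have := h.inj i; have := h.inj j; have := h.lt i; have := h.lt j
    unfold _root_.dupLast; split_ifs <;> grind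
  zero i hi := by have := h.zero i; unfold _root_.dupLast; split_ifs <;> omega
  avoid i j k hij hjk hk := by
    have := h.avoid i j k hij hjk; have := h.avoid i j n hij; have := h.inj i (by omega) n
    unfold _root_.dupLast; split_ifs <;> grind
  noDescent i hi := by
    have := h.noDescent i; have := h.inj (i + 1) (by omega) n
    unfold _root_.dupLast; split_ifs <;> grind
  noInvDescent i j k hij hjk hk := by
    have := h.noInvDescent i j k hij hjk; have := h.noInvDescent i j n hij
    unfold _root_.dupLast; split_ifs <;> grind

theorem endsUp_dupLast : EndsUp (n + 2) (dupLast n f) := by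
  intro i hi
  obtain rfl : i = n := by omega
  simp [dupLast]

/-- Between the last two letters `f n < f (n + 1)` there is no value: it would occur earlier and
form a `213` with them. -/
theorem Admissible.last_eq (h : Admissible (n + 2) f) (hu : EndsUp (n + 2) f) :
    f (n + 1) = f n + 1 := by
  have h1 := hu n rfl
  obtain ⟨i, hi, e⟩ := h.surj (f n + 1) (by have := h.lt (n+1); omega)
  by_contra hc
  have : i ≠ n + 1 := by rintro rfl; omega
  have : i ≠ n := by rintro rfl; omega
  have := h.avoid i n (n+1) (by omega)
  omega

theorem Admissible.dropLast (h : Admissible (n + 2) f) (hu : EndsUp (n + 2) f) :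
    Admissible (n + 1) (dropLast n f) := by
  have hl := h.last_eq hu
  -- The successor of `f n` is the letter dropped, so no other letter takes this value.
  have hne : ∀ i ≤ n, f i ≠ f n + 1 := fun i hi e => by have := h.inj i (by omega) (n+1); omega
  constructor
  · intro i hi
    have := h.lt i; have := h.lt (n+1); have := hne i; unfold _root_.dropLast; split_ifs <;> omega
  · intro i hi j hj
    have := h.inj i; have := h.inj j; have := hne i; have := hne j
    unfold _root_.dropLast; split_ifs <;> grind
  · intro i hi
    simp [_root_.dropLast]; omega
  · intro i j k hij hjk hk
    have := h.avoid i j k hij hjk; have := hne i; have := hne j; have := hne k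
    unfold _root_.dropLast; split_ifs <;> omega
  · intro i hi
    have := h.noDescent i; have := hne i; have := hne (i+1); have := hne (i+2)
    unfold _root_.dropLast; split_ifs <;> omega
  · intro i j k hij hjk hk
    have := h.noInvDescent i j k hij hjk; have := hne i; have := hne j; have := hne k
    have := h.noInvDescent i j (n+1) hij
    have := h.inj k (by omega) n; have := h.inj j (by omega) n
    unfold _root_.dropLast; split_ifs <;> grind

theorem dupLast_dropLast (h : Admissible (n + 2) f) (hu : EndsUp (n + 2) f) :
    dupLast n (dropLast n f) = f := by
  have hl := h.last_eq hu
  have hne : ∀ i ≤ n, f i ≠ f n + 1 := fun i hi e => by have := h.inj i (by omega) (n+1); omega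
  funext i
  have := h.zero i; have := hne i
  unfold dupLast dropLast; split_ifs <;> grind

/-- The last letter of `f` can be read off from `dupLast n f`, and with it which letters were
raised. -/
theorem dupLast_inj (hf : Admissible (n + 1) f) (hg : Admissible (n + 1) g)
    (h : dupLast n f = dupLast n g) : f = g := by
  funext i
  have h1 := congrFun h i
  have h2 := congrFun h (n + 1)
  have := hf.zero i; have := hg.zero i
  unfold dupLast at h1 h2; split_ifs at * <;> grind

end dup

/-! ### Permutations and their inverses -/

section inverse

variable {n : ℕ} {f g : ℕ → ℕ}

/-- `213` is an involution, and inversion exchanges the two conditions on double descents. -/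
theorem Admissible.inverse (h : Admissible n f) (hg : ∀ i < n, g i < n ∧ f (g i) = i)
    (h0 : ∀ i, n ≤ i → g i = 0) : Admissible n g where
  lt i hi := (hg i hi).1
  inj i hi j hj e := by rw [← (hg i hi).2, ← (hg j hj).2, e]
  zero := h0
  avoid i j k hij hjk hk h1 h2 := by
    have := hg i (by omega); have := hg j (by omega); have := hg k (by omega)
    have := h.avoid (g j) (g i) (g k) ; omega
  noDescent i hi h1 h2 := by
    have := hg i (by omega); have := hg (i+1) (by omega); have := hg (i+2) (by omega)
    have := h.noInvDescent (g (i+2)) (g (i+1)) (g i); omega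
  noInvDescent i j k hij hjk hk h1 h2 := by
    have := hg i (by omega); have := hg j (by omega); have := hg k (by omega)
    have := h.noDescent (g k); rw [← h1, ← h2] at this; omega

end inverse

/-- In a word avoiding `213`, a double descent of the subword of small letters comes from one of the
word itself. -/
theorem HasDoubleDescent.of_filter {w : List ℕ}
    (hw : ∀ x y z, [x, y, z].Sublist w → y < x → ¬ x < z) {k : ℕ}
    (h : HasDoubleDescent (w.filter (fun a => a ≤ k))) : HasDoubleDescent w := by
  obtain ⟨a, b, c, ⟨s, t, h⟩, hba, hcb⟩ := h
  rw [List.append_assoc, eq_comm, List.filter_eq_append_iff] at h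
  obtain ⟨w₁, w₂, rfl, -, h⟩ := h
  simp only [List.cons_append, List.nil_append, List.filter_eq_cons_iff] at h
  obtain ⟨p, q, rfl, -, ha, u, q', rfl, hu, hb, v, r, rfl, hv, hc, -⟩ := h
  simp only [decide_eq_true_eq, not_le] at ha hu hb hv hc
  -- A letter `y > k` between `b` and `c` would form the pattern `213` with `a` and `b`.
  have hv' : v = [] := by
    rcases v with _ | ⟨y, v⟩
    · rfl
    · exfalso
      have hy := hv y (by simp)
      refine hw a b y ?_ hba (by omega)
      have : [a, b, y].Sublist (a :: (u ++ b :: (y :: v ++ c :: r))) := by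
        refine List.Sublist.cons_cons a (List.Sublist.trans ?_ (List.sublist_append_right u _))
        exact List.Sublist.cons_cons b (List.Sublist.cons_cons y (List.nil_sublist _))
      exact this.trans ((List.sublist_append_right p _).trans (List.sublist_append_right w₁ _))
  subst hv'
  rcases List.eq_nil_or_concat u with rfl | ⟨u, x, rfl⟩
  · exact ⟨a, b, c, ⟨w₁ ++ p, r, by simp⟩, hba, hcb⟩
  -- The letter `x` just before `b` exceeds `k`, so it can play the part of `a`.
  · have := hu x (by simp)
    exact ⟨x, b, c, ⟨w₁ ++ p ++ a :: u, r, by simp⟩, by omega, hcb⟩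

section perm

variable {n : ℕ}

/-- A permutation of `Fin n` as a function on `ℕ`, equal to `0` beyond `n`. -/
def permFun (σ : Equiv.Perm (Fin n)) (i : ℕ) : ℕ := if h : i < n then σ ⟨i, h⟩ else 0

theorem permFun_val (σ : Equiv.Perm (Fin n)) (i : Fin n) : permFun σ i = σ i := by simp [permFun]

theorem permFun_lt (σ : Equiv.Perm (Fin n)) {i : ℕ} (h : i < n) : permFun σ i < n := by
  simp [permFun, h]

theorem permFun_injective : Function.Injective (permFun (n := n)) := by
  intro σ τ h
  ext i
  rw [← permFun_val, ← permFun_val, h]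

theorem permFun_inv (σ : Equiv.Perm (Fin n)) {i : ℕ} (h : i < n) :
    permFun σ (permFun σ⁻¹ i) = i := by
  simp [permFun, h]

theorem length_oneLine (σ : Equiv.Perm (Fin n)) : (oneLine σ).length = n := by simp [oneLine]

theorem getElem_oneLine (σ : Equiv.Perm (Fin n)) (i : ℕ) (h : i < (oneLine σ).length) :
    (oneLine σ)[i] = permFun σ i + 1 := by
  have : i < n := by simpa [oneLine] using h
  simp [oneLine, permFun, this]

theorem hasDoubleDescent_oneLine_iff (σ : Equiv.Perm (Fin n)) :
    HasDoubleDescent (oneLine σ) ↔ ∃ i, i + 2 < n ∧ permFun σ (i + 1) < permFun σ i ∧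
      permFun σ (i + 2) < permFun σ (i + 1) := by
  constructor
  · rintro ⟨a, b, c, ⟨s, t, h⟩, hba, hcb⟩
    have hl : s.length + 2 < n := by
      have := congrArg List.length h
      simp [length_oneLine] at this; omega
    have key : ∀ m (hm : m < 3), permFun σ (s.length + m) + 1 = [a, b, c][m] := by
      intro m hm
      rw [← getElem_oneLine σ _ (by rw [length_oneLine]; omega)]
      simp only [← h]
      rw [List.getElem_append_left (by simp; omega), List.getElem_append_right (by omega)]
      simp
    have h0 := key 0 (by omega)
    have h1 := key 1 (by omega)
    have h2 := key 2 (by omega)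
    simp at h0 h1 h2
    exact ⟨s.length, hl, by omega, by omega⟩
  · rintro ⟨i, hi, h1, h2⟩
    refine ⟨permFun σ i + 1, permFun σ (i + 1) + 1, permFun σ (i + 2) + 1, ?_, by omega, by omega⟩
    rw [List.infix_iff_getElem?]
    refine ⟨i, by simp [length_oneLine]; omega, ?_⟩
    intro j hj
    have hj : j < 3 := hj
    rw [List.getElem?_eq_getElem (by rw [length_oneLine]; omega), getElem_oneLine]
    interval_cases j <;> simp [Nat.add_comm]

theorem not_containsPattern_perm213_iff (σ : Equiv.Perm (Fin n)) :
    ¬ ContainsPattern σ perm213 ↔ ∀ i j k, i < j → j < k → k < n → permFun σ j < permFun σ i →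
      ¬ permFun σ i < permFun σ k := by
  constructor
  · intro h i j k hij hjk hk h1 h2
    refine h ⟨![⟨i, by omega⟩, ⟨j, by omega⟩, ⟨k, hk⟩], ?_, ?_⟩
    · intro a b hab
      fin_cases a <;> fin_cases b <;> simp_all; omega
    · have e1 := permFun_val σ ⟨i, by omega⟩
      have e2 := permFun_val σ ⟨j, by omega⟩
      have e3 := permFun_val σ ⟨k, by omega⟩
      simp only at e1 e2 e3
      intro a b
      fin_cases a <;> fin_cases b <;>
        simp [perm213, Fin.lt_def, Equiv.swap_apply_def, ← e1, ← e2, ← e3] <;> omega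
  · rintro h ⟨f, hf, hp⟩
    have h01 : f 0 < f 1 := hf (by decide)
    have h12 : f 1 < f 2 := hf (by decide)
    refine h (f 0) (f 1) (f 2) h01 h12 (f 2).2 ?_ ?_
    · simp only [permFun_val]; exact (hp 1 0).2 (by decide)
    · simp only [permFun_val]; exact (hp 0 2).2 (by decide)

/-- For a permutation avoiding `213`, the simsun condition on all subwords of small letters is
implied by the one on the whole word. -/
theorem isSimsun_iff (σ : Equiv.Perm (Fin n)) (hσ : ∀ i j k, i < j → j < k → k < n →
      permFun σ j < permFun σ i → ¬ permFun σ i < permFun σ k) :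
    IsSimsun σ ↔ ∀ i, i + 2 < n → permFun σ (i + 1) < permFun σ i →
      ¬ permFun σ (i + 2) < permFun σ (i + 1) := by
  have h1 : IsSimsun σ ↔ ¬ HasDoubleDescent (oneLine σ) := by
    constructor
    · intro h hd
      refine h n ?_
      rwa [List.filter_eq_self.2]
      intro a ha
      simp only [oneLine, List.mem_ofFn] at ha
      obtain ⟨i, rfl⟩ := ha
      simp
    · intro h k hd
      refine h (hd.of_filter fun x y z hs hyx hxz => ?_)
      obtain ⟨f, hf⟩ := List.sublist_iff_exists_fin_orderEmbedding_get_eq.1 hs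
      have e0 := hf 0
      have e1 := hf 1
      have e2 := hf 2
      simp only [List.get_eq_getElem, getElem_oneLine] at e0 e1 e2
      simp at e0 e1 e2
      have h01 : f 0 < f 1 := f.strictMono (show (0 : Fin 3) < 1 by decide)
      have h12 : f 1 < f 2 := f.strictMono (show (1 : Fin 3) < 2 by decide)
      have := (f 2).2.trans_eq (length_oneLine σ)
      exact hσ (f 0) (f 1) (f 2) h01 h12 this (by omega) (by omega)
  rw [h1, hasDoubleDescent_oneLine_iff]
  push Not
  rfl

theorem permFun_inv' (σ : Equiv.Perm (Fin n)) {i : ℕ} (h : i < n) :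
    permFun σ⁻¹ (permFun σ i) = i := by
  simpa using permFun_inv σ⁻¹ h

theorem avoids_inv {σ : Equiv.Perm (Fin n)} (hσ : ∀ i j k, i < j → j < k → k < n →
      permFun σ j < permFun σ i → ¬ permFun σ i < permFun σ k) : ∀ i j k, i < j → j < k → k < n →
      permFun σ⁻¹ j < permFun σ⁻¹ i → ¬ permFun σ⁻¹ i < permFun σ⁻¹ k := by
  intro i j k hij hjk hk h1 h2
  have := permFun_inv σ (i := i) (by omega)
  have := permFun_inv σ (i := j) (by omega)
  have := permFun_inv σ (i := k) (by omega)
  have := permFun_lt σ⁻¹ (i := k) (by omega)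
  have := hσ _ _ _ h1 h2
  omega

theorem admissible_permFun_iff (σ : Equiv.Perm (Fin n)) :
    Admissible n (permFun σ) ↔ σ ∈ doubleSimsunAvoiding n perm213 := by
  simp only [doubleSimsunAvoiding, IsDoubleSimsun, Set.mem_ofPred_eq,
    not_containsPattern_perm213_iff]
  constructor
  · intro h
    refine ⟨⟨(isSimsun_iff σ h.avoid).2 h.noDescent, ?_⟩, h.avoid⟩
    rw [isSimsun_iff σ⁻¹ (avoids_inv h.avoid)]
    intro i hi h1 h2
    have := permFun_inv σ (i := i) (by omega)
    have := permFun_inv σ (i := i+1) (by omega)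
    have := permFun_inv σ (i := i+2) (by omega)
    have := permFun_lt σ⁻¹ (i := i) (by omega)
    have := h.noInvDescent _ _ _ h2 h1
    omega
  · rintro ⟨⟨h1, h2⟩, h3⟩
    rw [isSimsun_iff σ h3] at h1
    rw [isSimsun_iff σ⁻¹ (avoids_inv h3)] at h2
    refine ⟨fun i hi => permFun_lt σ hi, ?_, ?_, h3, h1, ?_⟩
    · intro i hi j hj h
      rw [← permFun_inv' σ hi, h, permFun_inv' σ hj]
    · intro i hi
      simp [permFun]; omega
    · intro i j k hij hjk hk e1 e2
      have := permFun_inv' σ (i := i) (by omega)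
      have := permFun_inv' σ (i := j) (by omega)
      have := permFun_inv' σ (i := k) (by omega)
      have := permFun_lt σ (i := i) (by omega)
      have := h2 (permFun σ k)
      rw [← e1, ← e2] at this
      omega

theorem Admissible.exists_permFun {f : ℕ → ℕ} (h : Admissible n f) :
    ∃ σ : Equiv.Perm (Fin n), permFun σ = f := by
  refine ⟨Equiv.ofBijective (fun i : Fin n => (⟨f i, h.lt i i.2⟩ : Fin n))
    (Finite.injective_iff_bijective.1 ?_), ?_⟩
  · intro i j hij
    exact Fin.ext (h.inj i i.2 j j.2 (by simpa using hij))
  · funext i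
    by_cases hi : i < n
    · simp [permFun, hi]
    · rw [h.zero i (by omega)]; simp [permFun, hi]

theorem ncard_preimage_permFun {s : Set (ℕ → ℕ)} (hs : ∀ f ∈ s, Admissible n f) :
    {σ : Equiv.Perm (Fin n) | permFun σ ∈ s}.ncard = s.ncard := by
  rw [← Set.ncard_image_of_injective _ permFun_injective]
  congr 1
  ext f
  constructor
  · rintro ⟨σ, h, rfl⟩; exact h
  · intro h
    obtain ⟨σ, rfl⟩ := (hs f h).exists_permFun
    exact ⟨σ, h, rfl⟩

theorem finite_admissible : {f | Admissible n f}.Finite :=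
  (Set.finite_range (permFun (n := n))).subset fun _ h => h.exists_permFun

theorem Admissible.permFun_inv {σ : Equiv.Perm (Fin n)} (h : Admissible n (permFun σ)) :
    Admissible n (permFun σ⁻¹) :=
  h.inverse (fun _ hi => ⟨permFun_lt _ hi, _root_.permFun_inv σ hi⟩) fun i hi => by
    simp [permFun]; omega

theorem endsUp_permFun_inv_iff {σ : Equiv.Perm (Fin n)} :
    EndsUp n (permFun σ⁻¹) ↔ TopUp n (permFun σ) := by
  constructor
  · intro h i hi j hj h1 h2
    have := h (permFun σ i) h1
    rw [permFun_inv' σ hi, show permFun σ i + 1 = permFun σ j by omega, permFun_inv' σ hj] at this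
    exact this
  · rintro h i rfl
    exact h _ (permFun_lt _ (by omega)) _ (permFun_lt _ (by omega))
      (by rw [permFun_inv σ (by omega)])
      (by rw [permFun_inv σ (by omega)])

/-- Inversion exchanges the two conditions `EndsUp` and `TopUp`. -/
theorem ncard_topUp :
    {f | Admissible n f ∧ TopUp n f}.ncard = {f | Admissible n f ∧ EndsUp n f}.ncard := by
  rw [← ncard_preimage_permFun fun _ h => h.1, ← ncard_preimage_permFun fun _ h => h.1,
    ← Set.ncard_image_of_injective _ inv_injective]
  congr 1
  ext σ
  simp only [Set.image_inv_eq_inv, Set.mem_inv, Set.mem_ofPred_eq]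
  rw [← endsUp_permFun_inv_iff, inv_inv]
  exact and_congr_left fun _ => ⟨fun h => by simpa using h.permFun_inv, fun h => h.permFun_inv⟩

end perm

/-! ### Counting permutations -/

open Finset in
theorem eq_of_recurrence {f g : ℕ → ℕ} (h0 : f 0 = g 0) (h1 : f 1 = g 1) (h2 : f 2 = g 2)
    (hf : ∀ n, f (n + 3) = f (n + 2) + f (n + 1) + ∑ p ∈ antidiagonal n, f p.1 * f p.2)
    (hg : ∀ n, g (n + 3) = g (n + 2) + g (n + 1) + ∑ p ∈ antidiagonal n, g p.1 * g p.2) (n : ℕ) :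
    f n = g n := by
  induction n using Nat.strong_induction_on with
  | _ n ih =>
  match n, ih with
  | 0, _ => exact h0
  | 1, _ => exact h1
  | 2, _ => exact h2
  | n + 3, ih =>
    rw [hf, hg, ih (n + 2) (by omega), ih (n + 1) (by omega)]
    congr 1
    refine sum_congr rfl fun p hp => ?_
    have := mem_antidiagonal.1 hp
    rw [ih p.1 (by omega), ih p.2 (by omega)]

open Finset in
/-- The term `p.1 = 0` of the convolution vanishes and the term `p.2 = 0` is `f (n + 1)`; the others
form the convolution of `f` with itself. -/
theorem recurrence_of_sum {f g : ℕ → ℕ} (hg0 : g 0 = 1) (hg : ∀ n, g (n + 1) = f n)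
    (hf : ∀ n, f (n + 1) = f n + ∑ p ∈ antidiagonal n, if p.1 = 0 then 0 else g p.1 * g p.2)
    (n : ℕ) :
    f (n + 3) = f (n + 2) + f (n + 1) + ∑ p ∈ antidiagonal n, f p.1 * f p.2 := by
  rw [hf, Nat.sum_antidiagonal_succ, Nat.sum_antidiagonal_succ']
  simp only [Nat.add_eq_zero_iff, one_ne_zero, and_false, if_true, if_false, hg, hg0]
  simp [add_assoc]

section count

variable {n : ℕ}

/-- The functions encoding the `213`-avoiding double simsun permutations. -/
def admissibleSet (n : ℕ) : Set (ℕ → ℕ) := {f | Admissible n f}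

/-- The functions encoding the `213`-avoiding double simsun permutations not ending with a
descent. -/
def admissibleUpSet (n : ℕ) : Set (ℕ → ℕ) := {f | Admissible n f ∧ EndsUp n f}

theorem admissible_zero_iff {f} : Admissible 0 f ↔ f = 0 := by
  constructor
  · intro h; funext i; exact h.zero i (by omega)
  · rintro rfl; constructor <;> simp

theorem ncard_admissibleSet_zero : (admissibleSet 0).ncard = 1 := by
  simp [admissibleSet, admissible_zero_iff]

theorem ncard_admissibleUpSet_zero : (admissibleUpSet 0).ncard = 1 := by
  have : admissibleUpSet 0 = {0} := by
    ext f
    simp only [admissibleUpSet, admissible_zero_iff, Set.mem_ofPred_eq, Set.mem_singleton_iff,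
      and_iff_left_iff_imp]
    intro _ i hi; omega
  simp [this]

theorem endsUp_zero {f} : EndsUp 0 f := fun i hi => by omega

/-- Permutations starting with their least letter. -/
theorem fiber_zero : {f | Admissible (n + 1) f ∧ f 0 = 0}.ncard = (admissibleSet n).ncard := by
  have h0 : Admissible 0 0 := admissible_zero_iff.2 rfl
  have hinj : Set.InjOn (glue 0 n 0) (admissibleSet n) :=
    fun A hA B hB h => (glue_inj h0 hA h0 hB h).2
  rw [← hinj.ncard_image]
  congr 1
  ext f
  constructor
  · rintro ⟨h, hf⟩
    have h' : Admissible (0 + n + 1) f := by simpa using h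
    refine ⟨_, h'.rightPart hf, ?_⟩
    rw [← admissible_zero_iff.1 (h'.leftPart hf)]
    exact glue_leftPart_rightPart h' hf
  · rintro ⟨B, hB, rfl⟩
    have := h0.glue hB endsUp_zero (fun h => absurd rfl h)
    exact ⟨by simpa using this, glue_mid⟩

/-- Permutations with their least letter at position `a > 0`. -/
theorem fiber_pos {a b : ℕ} (ha : a ≠ 0) : {f | Admissible (a + b + 1) f ∧ f a = 0}.ncard =
    (admissibleUpSet a).ncard * (admissibleUpSet b).ncard := by
  have hinj : Set.InjOn (fun p : (ℕ → ℕ) × (ℕ → ℕ) => glue a b p.1 p.2)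
      (admissibleUpSet a ×ˢ {f | Admissible b f ∧ TopUp b f}) := by
    rintro ⟨A, B⟩ ⟨hA, hB⟩ ⟨A', B'⟩ ⟨hA', hB'⟩ h
    exact Prod.ext_iff.2 (glue_inj hA.1 hB.1 hA'.1 hB'.1 h)
  rw [admissibleUpSet, admissibleUpSet, ← ncard_topUp (n := b), ← Set.ncard_prod]
  refine Eq.trans ?_ hinj.ncard_image
  congr 1
  ext f
  constructor
  · rintro ⟨h, hf⟩
    exact ⟨⟨_, _⟩, ⟨⟨h.leftPart hf, h.endsUp_leftPart hf⟩, h.rightPart hf, h.topUp_rightPart hf ha⟩,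
      glue_leftPart_rightPart h hf⟩
  · rintro ⟨⟨A, B⟩, ⟨hA, hB⟩, rfl⟩
    exact ⟨hA.1.glue hB.1 hA.2 fun _ => hB.2, glue_mid⟩

open Finset in
/-- Sum over the position `p.1` of the least letter. -/
theorem ncard_admissibleSet_succ (n : ℕ) : (admissibleSet (n + 1)).ncard = (admissibleSet n).ncard +
    ∑ p ∈ antidiagonal n,
      if p.1 = 0 then 0 else (admissibleUpSet p.1).ncard * (admissibleUpSet p.2).ncard := by
  have hU : admissibleSet (n + 1) =
      ⋃ a ∈ (range (n + 1) : Set ℕ), {f | Admissible (n + 1) f ∧ f a = 0} := by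
    ext f
    simp only [admissibleSet, Set.mem_ofPred_eq, Set.mem_iUnion, Finset.coe_range, Set.mem_Iio]
    constructor
    · intro h
      obtain ⟨i, hi, e⟩ := h.surj 0 (by omega)
      exact ⟨i, hi, h, e⟩
    · rintro ⟨_, _, h, _⟩; exact h
  rw [hU, (Finset.finite_toSet _).ncard_biUnion, finsum_mem_coe_finset,
    Nat.sum_antidiagonal_eq_sum_range_succ_mk, sum_range_succ', sum_range_succ', fiber_zero]
  · simp only [Nat.add_eq_zero_iff, one_ne_zero, and_false, if_false, if_true, add_zero]
    rw [add_comm]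
    congr 1
    refine sum_congr rfl fun i hi => ?_
    have hi := mem_range.1 hi
    rw [← fiber_pos (by omega), show i + 1 + (n - (i + 1)) + 1 = n + 1 by omega]
  · exact fun a _ => finite_admissible.subset fun _ h => h.1
  · intro a ha b hb hab
    simp only [Finset.coe_range, Set.mem_Iio] at ha hb
    simp only [Function.onFun]
    rw [Set.disjoint_left]
    rintro f ⟨h, h1⟩ ⟨-, h2⟩
    exact hab (h.inj a ha b hb (h1.trans h2.symm))

theorem ncard_admissibleUpSet_succ (n : ℕ) :
    (admissibleUpSet (n + 1)).ncard = (admissibleSet n).ncard := by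
  rcases n with _ | n
  · have : admissibleUpSet 1 = admissibleSet 1 := by
      ext f
      simp only [admissibleSet, admissibleUpSet, Set.mem_ofPred_eq, and_iff_left_iff_imp]
      intro _ i hi; omega
    rw [this, ncard_admissibleSet_succ]
    simp
  · have hinj : Set.InjOn (dupLast n) (admissibleSet (n + 1)) :=
      fun f hf g hg h => dupLast_inj hf hg h
    rw [← hinj.ncard_image]
    congr 1
    ext f
    constructor
    · rintro ⟨h, hu⟩
      exact ⟨_, h.dropLast hu, dupLast_dropLast h hu⟩
    · rintro ⟨g, hg, rfl⟩
      exact ⟨hg.dupLast, endsUp_dupLast⟩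

theorem ncard_admissibleSet (n : ℕ) :
    (admissibleSet n).ncard = {t : FoldTree | t.size = n}.ncard := by
  have h0 := ncard_admissibleSet_zero
  have h1 := ncard_admissibleSet_succ 0
  have h2 := ncard_admissibleSet_succ 1
  have g1 := ncard_admissibleUpSet_succ 0
  have g0 := ncard_admissibleUpSet_zero
  simp [-Set.ncard_eq_one, h0, g0, g1, Finset.Nat.antidiagonal_succ] at h1 h2
  refine eq_of_recurrence (f := fun n => (admissibleSet n).ncard)
    (g := fun n => {t : FoldTree | t.size = n}.ncard) ?_ ?_ ?_ (recurrence_of_sum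
    (f := fun n => (admissibleSet n).ncard) (g := fun n => (admissibleUpSet n).ncard)
    ncard_admissibleUpSet_zero ncard_admissibleUpSet_succ
    ncard_admissibleSet_succ) FoldTree.ncard_size_add_three n
  · simp [h0, FoldTree.size_eq_zero]
  · simp [h1, FoldTree.size_eq_one]
  · rw [h2, h1, FoldTree.size_eq_two, Set.ncard_pair (by simp)]

end count

theorem mainTheorem2 (n : ℕ) :
    (doubleSimsunAvoiding n perm213).ncard = secondaryStructureNumber n ∧
      secondaryStructureNumber n = (ddFreeMotzkinPaths n).ncard := by
  rw [FoldTree.secondaryStructureNumber_eq, FoldTree.ncard_ddFreeMotzkinPaths,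
    ← ncard_admissibleSet]
  refine ⟨?_, rfl⟩
  rw [← ncard_preimage_permFun (s := admissibleSet n) fun _ h => h]
  congr 1
  ext σ
  exact (admissible_permFun_iff σ).symm
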